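/- Let $M$ be a smooth $n$-dimensional manifold and let $(M,K)$ be a Cartan space: $K:T^*M\to\mathbb{R}$ is continuous, smooth and positive on $T^*M\setminus 0$ (the cotangent bundle without its null section), positively $1$-homogeneous on the fibres, and in all induced coordinates $(x^i,p_i)$ the matrix $g^{ij}=\frac12\frac{\partial^2K^2}{\partial p_i\partial p_j}$ is positive definite at every point of $T^*M\setminus 0$. Let $(g_{ij})=(g^{ij})^{-1}$, $\{f,h\}=\frac{\partial f}{\partial p_k}\frac{\partial h}{\partial x^k}-\frac{\partial h}{\partial p_k}\frac{\partial f}{\partial x^k}$, $$N_{ij}=\tfrac14\{g_{ij},K^2\}-\tfrac14\Big(g_{ik}\frac{\partial^2K^2}{\partial p_k\partial x^j}+g_{jk}\frac{\partial^2K^2}{\partial p_k\partial x^i}\Big),\qquad \delta p_i=dp_i-N_{ij}\,dx^j,$$ let $G=g_{ij}\,dx^i\otimes dx^j+g^{ij}\,\delta p_i\otimes\delta p_j$ be the Sasaki lift on $T^*M\setminus 0$, let $\nabla$ be its Levi-Civita connection, and let $VT^*M$ be the vertical foliation, spanned by $\partial/\partial p_1,\dots,\partial/\partial p_n$. The metric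 $G$ is called bundle-like for $VT^*M$ if $G(\nabla_XY+\nabla_YX,Z)=0$ for all locally defined smooth vector fields $X,Y$ that are $G$-orthogonal to $VT^*M$ and all locally defined smooth vertical vector fields $Z$. Put $g_{ijk}=g_{is}g_{jt}g_{kh}\,\partial g^{st}/\partial p_h$. Say that $(g^{ij})$ is a Riemannian metric on $M$ if there is a smooth Riemannian metric $h$ on $M$ with $h=g_{ij}(x,p)\,dx^i\otimes dx^j$ at $x$ for every $(x,p)\in T^*M\setminus 0$, in all induced coordinates. Then: 1. $G$ is bundle-like for $VT^*M$ if and only if $g_{ijk}=0$ on $T^*M\setminus 0$. 2. If $(g^{ij})$ is a Riemannian metric on $M$, then $G$ is bundle-like for $VT^*M$. 3. If $n\neq 1$, then $G$ is bundle-like for $VT^*M$ if and only if $(g^{ij})$ does not depend on $p$ and is a Riemannian metric on $M$. -/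

import Mathlib

open scoped Manifold ContDiff Matrix

noncomputable section

namespace CartanSpaces

/-! ### Local coordinates `(x, p)`: coordinate `Sum.inl i` is `x^i`, coordinate `Sum.inr i` is `p_i`. -/

/-- The coordinate space of the induced coordinates `(x^i, p_i)`. -/
abbrev Coord (n : ℕ) : Type := Fin n ⊕ Fin n → ℝ

/-- The partial derivative of a function of finitely many real variables. -/
def pd {ι : Type*} [Fintype ι] [DecidableEq ι] (a : ι) (f : (ι → ℝ) → ℝ) (z : ι → ℝ) : ℝ :=
  fderiv ℝ f z (Pi.single a 1)

/-! ### Levi-Civita connection and bundle-like metrics on a coordinate domain -/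

section Riemannian

variable {ι : Type*} [Fintype ι] [DecidableEq ι]

/-- Christoffel symbols `Γ^c_{ab}` of the metric with coordinate matrix `G`. -/
def christoffel (G : (ι → ℝ) → Matrix ι ι ℝ) (z : ι → ℝ) (c a b : ι) : ℝ :=
  (1 / 2) * ∑ d, (G z)⁻¹ c d *
    (pd a (fun w => G w b d) z + pd b (fun w => G w a d) z - pd d (fun w => G w a b) z)

/-- The Levi-Civita covariant derivative `∇_X Y` of the metric with coordinate matrix `G`. -/
def leviCivita (G : (ι → ℝ) → Matrix ι ι ℝ) (X Y : (ι → ℝ) → (ι → ℝ)) (z : ι → ℝ) : ι → ℝ :=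
  fun c => (∑ a, X z a * pd a (fun w => Y w c) z)
    + ∑ a, ∑ b, christoffel G z c a b * X z a * Y z b

/-- The value `G_z(v, w)`. -/
def pairing (G : (ι → ℝ) → Matrix ι ι ℝ) (z v w : ι → ℝ) : ℝ := v ⬝ᵥ (G z *ᵥ w)

/-- The metric `G` on the open set `Ω` is bundle-like for the foliation with tangent
distribution `D`: one has `G(∇_X Y + ∇_Y X, Z) = 0` for all smooth sections `X, Y` of the
`G`-orthogonal complement of `D` and all smooth sections `Z` of `D`, defined on open parts of `Ω`. -/
def BundleLikeOn (Ω : Set (ι → ℝ)) (G : (ι → ℝ) → Matrix ι ι ℝ)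
    (D : (ι → ℝ) → Submodule ℝ (ι → ℝ)) : Prop :=
  ∀ W : Set (ι → ℝ), IsOpen W → W ⊆ Ω → ∀ X Y Z : (ι → ℝ) → (ι → ℝ),
    ContDiffOn ℝ ∞ X W → ContDiffOn ℝ ∞ Y W → ContDiffOn ℝ ∞ Z W →
    (∀ z ∈ W, ∀ v ∈ D z, pairing G z (X z) v = 0) →
    (∀ z ∈ W, ∀ v ∈ D z, pairing G z (Y z) v = 0) →
    (∀ z ∈ W, Z z ∈ D z) →
    ∀ z ∈ W, pairing G z (leviCivita G X Y z + leviCivita G Y X z) (Z z) = 0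

end Riemannian

/-! ### Geometry of a function `H = K²` of the coordinates `(x, p)` -/

section Local

variable {n : ℕ}

/-- `g^{ij} = (1/2) ∂²H/∂p_i∂p_j`. -/
def gUp (H : Coord n → ℝ) (z : Coord n) : Matrix (Fin n) (Fin n) ℝ :=
  Matrix.of fun i j => (1 / 2) * pd (Sum.inr i) (pd (Sum.inr j) H) z

/-- `(g_{ij})`, the inverse matrix of `(g^{ij})`. -/
def gLow (H : Coord n → ℝ) (z : Coord n) : Matrix (Fin n) (Fin n) ℝ := (gUp H z)⁻¹

/-- The Poisson bracket `{f, h} = ∂f/∂p_i ∂h/∂x^i - ∂h/∂p_i ∂f/∂x^i`. -/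
def poisson (f h : Coord n → ℝ) (z : Coord n) : ℝ :=
  ∑ i, (pd (Sum.inr i) f z * pd (Sum.inl i) h z - pd (Sum.inr i) h z * pd (Sum.inl i) f z)

/-- The coefficients `N_{ij}` of the canonical nonlinear connection. -/
def nonlinearConnection (H : Coord n → ℝ) (z : Coord n) : Matrix (Fin n) (Fin n) ℝ :=
  Matrix.of fun i j =>
    (1 / 4) * poisson (fun w => gLow H w i j) H z
      - (1 / 4) * ∑ k, (gLow H z i k * pd (Sum.inr k) (pd (Sum.inl j) H) z
          + gLow H z j k * pd (Sum.inr k) (pd (Sum.inl i) H) z)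

/-- The coframe `dx^i`; row `i` holds the components of `dx^i` in the coordinates `(x, p)`. -/
def dxCoframe (n : ℕ) : Matrix (Fin n) (Fin n ⊕ Fin n) ℝ := Matrix.fromCols 1 0

/-- The adapted coframe `δp_i = dp_i - N_{ij} dx^j`; row `i` holds the components of `δp_i`. -/
def deltaPCoframe (H : Coord n → ℝ) (z : Coord n) : Matrix (Fin n) (Fin n ⊕ Fin n) ℝ :=
  Matrix.fromCols (-nonlinearConnection H z) 1

/-- The Sasaki lift `G = g_{ij} dx^i ⊗ dx^j + g^{ij} δp_i ⊗ δp_j`. -/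
def sasakiLift (H : Coord n → ℝ) (z : Coord n) : Matrix (Fin n ⊕ Fin n) (Fin n ⊕ Fin n) ℝ :=
  (dxCoframe n)ᵀ * gLow H z * dxCoframe n
    + (deltaPCoframe H z)ᵀ * gUp H z * deltaPCoframe H z

/-- The vertical distribution, spanned by `∂/∂p_1, …, ∂/∂p_n`. -/
def vertical (n : ℕ) : Coord n → Submodule ℝ (Coord n) := fun _ =>
  Submodule.span ℝ (Set.range fun i : Fin n => (Pi.single (Sum.inr i) 1 : Coord n))

/-- `g_{ijk} = g_{is} g_{jt} g_{kh} ∂g^{st}/∂p_h`. -/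
def gTensor (H : Coord n → ℝ) (z : Coord n) (i j k : Fin n) : ℝ :=
  ∑ s, ∑ t, ∑ h, gLow H z i s * gLow H z j t * gLow H z k h *
    pd (Sum.inr h) (fun w => gUp H w s t) z

end Local

/-! ### Cartan spaces -/

section Global

variable (n : ℕ) (M : Type*) [TopologicalSpace M] [ChartedSpace (EuclideanSpace ℝ (Fin n)) M]
  [IsManifold (𝓡 n) ∞ M]

/-- The total space of the cotangent bundle `T*M`. -/
abbrev Cotangent : Type _ :=
  Bundle.TotalSpace (EuclideanSpace ℝ (Fin n) →L[ℝ] ℝ)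
    (fun x : M => TangentSpace (𝓡 n) x →L[ℝ] Bundle.Trivial M ℝ x)

variable {n M}

/-- The point of the chart codomain with coordinates `x^i`. -/
def basePoint (z : Coord n) : EuclideanSpace ℝ (Fin n) := WithLp.toLp 2 fun i => z (Sum.inl i)

/-- The covector `dx^i` at a point of the domain of the chart `e`. -/
def dxAt (e : OpenPartialHomeomorph M (EuclideanSpace ℝ (Fin n))) (x : M) (i : Fin n) :
    TangentSpace (𝓡 n) x →L[ℝ] ℝ :=
  (EuclideanSpace.proj i : EuclideanSpace ℝ (Fin n) →L[ℝ] ℝ).comp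
    (mfderiv (𝓡 n) 𝓘(ℝ, EuclideanSpace ℝ (Fin n)) e x)

/-- The point `p_i dx^i ∈ T*_x M` with induced coordinates `(x, p)` with respect to `e`. -/
def cotangentPoint (e : OpenPartialHomeomorph M (EuclideanSpace ℝ (Fin n))) (z : Coord n) :
    Cotangent n M :=
  ⟨e.symm (basePoint z), ∑ i, z (Sum.inr i) • dxAt e (e.symm (basePoint z)) i⟩

/-- The coordinate domain of `T*M` without its null section that is induced by the chart `e`. -/
def slitDomain (e : OpenPartialHomeomorph M (EuclideanSpace ℝ (Fin n))) : Set (Coord n) :=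
  {z | basePoint z ∈ e.target ∧ ∃ i, z (Sum.inr i) ≠ 0}

/-- The function `K²` in the induced coordinates. -/
def localSq (K : Cotangent n M → ℝ) (e : OpenPartialHomeomorph M (EuclideanSpace ℝ (Fin n))) :
    Coord n → ℝ :=
  fun z => K (cotangentPoint e z) ^ 2

/-- `(M, K)` is a Cartan space. -/
structure IsCartanSpace (K : Cotangent n M → ℝ) : Prop where
  continuous : Continuous K
  smooth : ContMDiffOn ((𝓡 n).prod 𝓘(ℝ, EuclideanSpace ℝ (Fin n) →L[ℝ] ℝ)) 𝓘(ℝ, ℝ) ∞ K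
    {z | z.2 ≠ 0}
  pos : ∀ z : Cotangent n M, z.2 ≠ 0 → 0 < K z
  homogeneous : ∀ (z : Cotangent n M) (t : ℝ), 0 < t → K ⟨z.1, t • z.2⟩ = t * K z
  posDef : ∀ e ∈ IsManifold.maximalAtlas (𝓡 n) ∞ M, ∀ z ∈ slitDomain e,
    (gUp (localSq K e) z).PosDef

/-- The Sasaki lift `G` of the Cartan space is bundle-like for the vertical foliation of `T*M`
(without the null section). The condition is local, so it is imposed on all induced coordinate
domains. -/
def SasakiBundleLikeVertical (K : Cotangent n M → ℝ) : Prop :=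
  ∀ e ∈ IsManifold.maximalAtlas (𝓡 n) ∞ M,
    BundleLikeOn (slitDomain e) (sasakiLift (localSq K e)) (vertical n)

/-- `g_{ijk} = 0`, in all induced coordinates. -/
def GTensorVanishes (K : Cotangent n M → ℝ) : Prop :=
  ∀ e ∈ IsManifold.maximalAtlas (𝓡 n) ∞ M, ∀ z ∈ slitDomain e,
    ∀ i j k, gTensor (localSq K e) z i j k = 0

/-- The functions `g^{ij}(x, p)` do not depend on `p`, in all induced coordinates. -/
def IndependentOfMomenta (K : Cotangent n M → ℝ) : Prop :=
  ∀ e ∈ IsManifold.maximalAtlas (𝓡 n) ∞ M, ∀ z ∈ slitDomain e, ∀ w ∈ slitDomain e,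
    basePoint z = basePoint w → gUp (localSq K e) z = gUp (localSq K e) w

/-- `(g^{ij})` is a Riemannian metric on `M`: there is a smooth Riemannian metric `h` on `M` with
`h = g_{ij} dx^i ⊗ dx^j` at each point `(x, p)`, `p ≠ 0`, in all induced coordinates. -/
def IsRiemannianMetricOnBase (K : Cotangent n M → ℝ) : Prop :=
  ∃ h : Bundle.ContMDiffRiemannianMetric (𝓡 n) ∞ (EuclideanSpace ℝ (Fin n))
      (fun x : M => TangentSpace (𝓡 n) x),
    ∀ e ∈ IsManifold.maximalAtlas (𝓡 n) ∞ M, ∀ z ∈ slitDomain e,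
      ∀ v w : TangentSpace (𝓡 n) (e.symm (basePoint z)),
        h.inner (e.symm (basePoint z)) v w =
          ∑ i, ∑ j, gLow (localSq K e) z i j *
            dxAt e (e.symm (basePoint z)) i v * dxAt e (e.symm (basePoint z)) j w

end Global

end CartanSpaces

end

/-! For fields `X`, `Y` orthogonal to a constant field `ζ`, differentiating `G(X, ζ) = 0` and `G(Y,
ζ) = 0` cancels all derivatives of `X` and `Y` in the coordinate Koszul formula, leaving `G(∇_X Y +
∇_Y X, ζ) = -(∂_ζ G)(X, Y)`. Constant `ζ` suffice: the vertical distribution is constant in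
coordinates and only the value of `Z` at the point matters. Since `δp` kills horizontal vectors,
differentiating `g^{ij} δp_i ⊗ δp_j` contributes nothing on a horizontal pair. Hence bundle-like
means `∂g_{ij}/∂p_k = 0` (`bundleLikeOn_sasakiLift_iff`), and `g_{ijk} = -g_{kh} ∂g_{ij}/∂p_h`
(`gTensor_eq`) turns this into `g_{ijk} = 0`.

A Riemannian metric on the base has coefficients free of `p`, so these derivatives vanish.
Conversely, for `n ≥ 2` the punctured fibre is connected and vanishing derivatives make `g_{ij}`
constant on it; for `n = 0` the slit domains are empty. A change of chart acts linearly on each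
fibre, so `g_{ij} dx^i ⊗ dx^j` transforms as a tensor (`chartForm_eq_chartForm`). Once it is free of
`p`, its chart expressions agree and glue to a smooth metric. -/

noncomputable section

namespace CartanSpaces

/-! ### Smoothness of partial derivatives, determinants and inverse matrices -/

section Calculus

variable {ι : Type*} [Fintype ι] [DecidableEq ι]

theorem contDiffOn_pd {Ω : Set (ι → ℝ)} (hΩ : IsOpen Ω) {f : (ι → ℝ) → ℝ}
    (hf : ContDiffOn ℝ ∞ f Ω) (a : ι) : ContDiffOn ℝ ∞ (pd a f) Ω := by
  have h : ContDiffOn ℝ ∞ (fderiv ℝ f) Ω := hf.fderiv_of_isOpen hΩ (by simp)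
  exact h.clm_apply contDiffOn_const

theorem sum_mul_pd (f : (ι → ℝ) → ℝ) (z v : ι → ℝ) :
    ∑ a, v a * pd a f z = fderiv ℝ f z v := by
  conv_rhs => rw [pi_eq_sum_univ' v]
  simp only [map_sum, map_smul, smul_eq_mul, pd]

theorem contDiffOn_det {E κ : Type*} [NormedAddCommGroup E] [NormedSpace ℝ E] [Fintype κ]
    [DecidableEq κ] {Ω : Set E} {A : E → Matrix κ κ ℝ}
    (hA : ∀ i j, ContDiffOn ℝ ∞ (fun z => A z i j) Ω) :
    ContDiffOn ℝ ∞ (fun z => (A z).det) Ω := by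
  simp only [Matrix.det_apply']
  exact ContDiffOn.sum fun σ _ => contDiffOn_const.mul (contDiffOn_prod fun i _ => hA _ _)

/-- Cramer's rule: an adjugate entry is the determinant of the matrix with one row replaced by a
basis vector. -/
theorem contDiffOn_inv_matrix {E κ : Type*} [NormedAddCommGroup E] [NormedSpace ℝ E] [Fintype κ]
    [DecidableEq κ] {Ω : Set E} {A : E → Matrix κ κ ℝ}
    (hA : ∀ i j, ContDiffOn ℝ ∞ (fun z => A z i j) Ω) (hdet : ∀ z ∈ Ω, (A z).det ≠ 0) (i j : κ) :
    ContDiffOn ℝ ∞ (fun z => (A z)⁻¹ i j) Ω := by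
  have h : ContDiffOn ℝ ∞ (fun z => ((A z).updateRow j (Pi.single i 1)).det) Ω := by
    refine contDiffOn_det fun k l => ?_
    by_cases hk : k = j
    · subst hk
      simpa using contDiffOn_const
    · simpa [Matrix.updateRow_ne hk] using hA k l
  have h2 := ((contDiffOn_det hA).inv hdet).mul h
  refine h2.congr fun z _ => ?_
  simp [Matrix.inv_def, Matrix.adjugate_apply]

theorem contDiffOn_matrix_mul {E κ μ ν : Type*} [NormedAddCommGroup E] [NormedSpace ℝ E] [Fintype μ]
    {Ω : Set E} {A : E → Matrix κ μ ℝ} {B : E → Matrix μ ν ℝ}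
    (hA : ∀ i j, ContDiffOn ℝ ∞ (fun z => A z i j) Ω)
    (hB : ∀ i j, ContDiffOn ℝ ∞ (fun z => B z i j) Ω) (i : κ) (j : ν) :
    ContDiffOn ℝ ∞ (fun z => (A z * B z) i j) Ω := by
  simp only [Matrix.mul_apply]
  exact ContDiffOn.sum fun k _ => (hA _ _).mul (hB _ _)

end Calculus

/-! ### The Levi-Civita connection paired with a constant vector -/

section Riemannian

variable {ι : Type*} [Fintype ι] [DecidableEq ι]

/-- Lowering the upper index cancels `(G z)⁻¹`, which then disappears from all later formulas. -/
theorem sum_christoffel_mul {G : (ι → ℝ) → Matrix ι ι ℝ} {z : ι → ℝ}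
    (hdet : (G z).det ≠ 0) (hsymm : (G z).IsSymm) (a b d : ι) :
    ∑ c, christoffel G z c a b * G z c d =
      (1 / 2) * (pd a (fun w => G w b d) z + pd b (fun w => G w a d) z
        - pd d (fun w => G w a b) z) := by
  have h1 : G z * (G z)⁻¹ = 1 := Matrix.mul_nonsing_inv _ (isUnit_iff_ne_zero.2 hdet)
  simp only [christoffel, Finset.mul_sum, Finset.sum_mul]
  rw [Finset.sum_comm]
  have h2 : ∀ e, ∑ c, (G z)⁻¹ c e * G z c d = if d = e then 1 else 0 := by
    intro e
    have := congrFun (congrFun h1 d) e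
    rw [Matrix.mul_apply, Matrix.one_apply] at this
    rw [← this]
    refine Finset.sum_congr rfl fun c _ => ?_
    rw [hsymm.apply c d, mul_comm]
  have h3 : ∀ e, ∑ c, (1 / 2 : ℝ) * ((G z)⁻¹ c e * (pd a (fun w => G w b e) z +
      pd b (fun w => G w a e) z - pd e (fun w => G w a b) z)) * G z c d =
      (if d = e then 1 else 0) * ((1 / 2) * (pd a (fun w => G w b e) z +
      pd b (fun w => G w a e) z - pd e (fun w => G w a b) z)) := by
    intro e
    rw [← h2, Finset.sum_mul]
    exact Finset.sum_congr rfl fun c _ => by ring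
  rw [Finset.sum_congr rfl fun e _ => h3 e]
  simp

theorem pairing_eq_sum {κ : Type*} [Fintype κ] (G : (κ → ℝ) → Matrix κ κ ℝ) (z v w : κ → ℝ) :
    pairing G z v w = ∑ c, ∑ d, v c * G z c d * w d := by
  simp only [pairing, dotProduct, Matrix.mulVec, Finset.mul_sum, mul_assoc]

theorem pairing_leviCivita {G : (ι → ℝ) → Matrix ι ι ℝ} {z : ι → ℝ}
    (hdet : (G z).det ≠ 0) (hsymm : (G z).IsSymm) (X Y : (ι → ℝ) → (ι → ℝ)) (ζ : ι → ℝ) :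
    pairing G z (leviCivita G X Y z) ζ =
      ∑ c, ∑ d, fderiv ℝ (fun w => Y w c) z (X z) * G z c d * ζ d
      + (1 / 2) * (∑ b, ∑ d, Y z b * fderiv ℝ (fun w => G w b d) z (X z) * ζ d
        + ∑ a, ∑ d, X z a * fderiv ℝ (fun w => G w a d) z (Y z) * ζ d
        - ∑ a, ∑ b, X z a * fderiv ℝ (fun w => G w a b) z ζ * Y z b) := by
  rw [pairing_eq_sum]
  have h : ∀ c d, leviCivita G X Y z c * G z c d * ζ d =
      fderiv ℝ (fun w => Y w c) z (X z) * G z c d * ζ d +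
      ∑ a, ∑ b, (christoffel G z c a b * G z c d) * (X z a * Y z b * ζ d) := by
    intro c d
    simp only [leviCivita, sum_mul_pd, add_mul, Finset.sum_mul]
    congr 1
    exact Finset.sum_congr rfl fun a _ => Finset.sum_congr rfl fun b _ => by ring
  simp only [h, Finset.sum_add_distrib]
  congr 1
  have h2 : ∑ c, ∑ d, ∑ a, ∑ b, (christoffel G z c a b * G z c d) * (X z a * Y z b * ζ d) =
      ∑ d, ∑ a, ∑ b, (∑ c, christoffel G z c a b * G z c d) * (X z a * Y z b * ζ d) := by
    rw [Finset.sum_comm]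
    refine Finset.sum_congr rfl fun d _ => ?_
    rw [Finset.sum_comm]
    refine Finset.sum_congr rfl fun a _ => ?_
    rw [Finset.sum_comm]
    refine Finset.sum_congr rfl fun b _ => ?_
    rw [Finset.sum_mul]
  rw [h2]
  simp only [sum_christoffel_mul hdet hsymm, ← sum_mul_pd, mul_add, mul_sub, add_mul, sub_mul,
    Finset.sum_add_distrib, Finset.sum_sub_distrib]
  simp only [Finset.mul_sum, Finset.sum_mul]
  congr 1
  · congr 1
    · rw [Finset.sum_congr rfl fun d _ => Finset.sum_comm, Finset.sum_comm]
      refine Finset.sum_congr rfl fun _ _ => Finset.sum_congr rfl fun _ _ =>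
        Finset.sum_congr rfl fun _ _ => by ring
    · rw [Finset.sum_comm]
      refine Finset.sum_congr rfl fun _ _ => Finset.sum_congr rfl fun _ _ =>
        Finset.sum_congr rfl fun _ _ => by ring
  · rw [Finset.sum_comm, Finset.sum_congr rfl fun d _ => Finset.sum_comm]
    refine Finset.sum_congr rfl fun _ _ => Finset.sum_congr rfl fun _ _ =>
      Finset.sum_congr rfl fun _ _ => by ring

/-- If `X` is orthogonal to the constant field `ζ`, the derivative of `G(X, ζ) = 0` along `v`. -/
theorem sum_fderiv_of_orthogonal {κ : Type*} [Fintype κ] {G : (κ → ℝ) → Matrix κ κ ℝ} {z : κ → ℝ}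
    (hG : ∀ a b, DifferentiableAt ℝ (fun w => G w a b) z) {X : (κ → ℝ) → (κ → ℝ)}
    (hX : DifferentiableAt ℝ X z) {ζ : κ → ℝ}
    (h : ∀ᶠ w in nhds z, pairing G w (X w) ζ = 0) (v : κ → ℝ) :
    ∑ c, ∑ d, fderiv ℝ (fun w => X w c) z v * G z c d * ζ d
      + ∑ b, ∑ d, X z b * fderiv ℝ (fun w => G w b d) z v * ζ d = 0 := by
  have hXc : ∀ c, DifferentiableAt ℝ (fun w => X w c) z := differentiableAt_pi.1 hX
  have h1 : HasFDerivAt (fun w => ∑ c, ∑ d, X w c * G w c d * ζ d)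
      (∑ c, ∑ d, ζ d • (X z c • fderiv ℝ (fun w => G w c d) z
        + G z c d • fderiv ℝ (fun w => X w c) z)) z :=
    HasFDerivAt.fun_sum fun c _ => HasFDerivAt.fun_sum fun d _ =>
      ((hXc c).hasFDerivAt.mul (hG c d).hasFDerivAt).mul_const _
  have h2 : (fun w => ∑ c, ∑ d, X w c * G w c d * ζ d) =ᶠ[nhds z] fun _ => 0 := by
    filter_upwards [h] with w hw
    rw [← pairing_eq_sum, hw]
  have h3 := (h1.unique ((hasFDerivAt_const (0 : ℝ) z).congr_of_eventuallyEq h2))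
  have h4 := congrArg (fun L : (κ → ℝ) →L[ℝ] ℝ => L v) h3
  simp only [sum_apply, smul_apply,
    add_apply, smul_eq_mul, zero_apply] at h4
  rw [← h4, ← Finset.sum_add_distrib]
  refine Finset.sum_congr rfl fun c _ => ?_
  rw [← Finset.sum_add_distrib]
  exact Finset.sum_congr rfl fun d _ => by ring

/-- For fields `X`, `Y` orthogonal to the constant field `ζ`, one has
`G(∇_X Y + ∇_Y X, ζ) = -(∂_ζ G)(X, Y)`. -/
theorem pairing_leviCivita_add_of_orthogonal {G : (ι → ℝ) → Matrix ι ι ℝ} {z : ι → ℝ}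
    (hG : ∀ a b, DifferentiableAt ℝ (fun w => G w a b) z)
    (hdet : (G z).det ≠ 0) (hsymm : ∀ᶠ w in nhds z, (G w).IsSymm) {X Y : (ι → ℝ) → (ι → ℝ)}
    (hX : DifferentiableAt ℝ X z) (hY : DifferentiableAt ℝ Y z) {ζ : ι → ℝ}
    (hXζ : ∀ᶠ w in nhds z, pairing G w (X w) ζ = 0)
    (hYζ : ∀ᶠ w in nhds z, pairing G w (Y w) ζ = 0) :
    pairing G z (leviCivita G X Y z + leviCivita G Y X z) ζ =
      -∑ a, ∑ b, X z a * fderiv ℝ (fun w => G w a b) z ζ * Y z b := by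
  have hadd : pairing G z (leviCivita G X Y z + leviCivita G Y X z) ζ =
      pairing G z (leviCivita G X Y z) ζ + pairing G z (leviCivita G Y X z) ζ := by
    simp [pairing, add_dotProduct]
  have hs : ∑ a, ∑ b, Y z a * fderiv ℝ (fun w => G w a b) z ζ * X z b =
      ∑ a, ∑ b, X z a * fderiv ℝ (fun w => G w a b) z ζ * Y z b := by
    rw [Finset.sum_comm]
    refine Finset.sum_congr rfl fun a _ => Finset.sum_congr rfl fun b _ => ?_
    have : (fun w => G w b a) =ᶠ[nhds z] fun w => G w a b := by
      filter_upwards [hsymm] with w hw using hw.apply a b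
    rw [this.fderiv_eq]
    ring
  rw [hadd, pairing_leviCivita hdet hsymm.self_of_nhds, pairing_leviCivita hdet hsymm.self_of_nhds,
    hs]
  -- The sum contains exactly the two expressions that orthogonality of `X` and of `Y` to `ζ` makes
  -- zero.
  linarith [sum_fderiv_of_orthogonal hG hX hXζ (Y z), sum_fderiv_of_orthogonal hG hY hYζ (X z)]

end Riemannian

/-! ### The Sasaki lift on a coordinate domain -/

section Local

variable {n : ℕ} {H : Coord n → ℝ} {Ω : Set (Coord n)}

theorem contDiffOn_gUp (hΩ : IsOpen Ω) (hH : ContDiffOn ℝ ∞ H Ω) (i j : Fin n) :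
    ContDiffOn ℝ ∞ (fun z => gUp H z i j) Ω :=
  contDiffOn_const.mul (contDiffOn_pd hΩ (contDiffOn_pd hΩ hH _) _)

theorem contDiffOn_gLow (hΩ : IsOpen Ω) (hH : ContDiffOn ℝ ∞ H Ω)
    (hpos : ∀ z ∈ Ω, (gUp H z).PosDef) (i j : Fin n) :
    ContDiffOn ℝ ∞ (fun z => gLow H z i j) Ω :=
  contDiffOn_inv_matrix (contDiffOn_gUp hΩ hH) (fun z hz => (hpos z hz).det_pos.ne') i j

theorem contDiffOn_nonlinearConnection (hΩ : IsOpen Ω) (hH : ContDiffOn ℝ ∞ H Ω)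
    (hpos : ∀ z ∈ Ω, (gUp H z).PosDef) (i j : Fin n) :
    ContDiffOn ℝ ∞ (fun z => nonlinearConnection H z i j) Ω := by
  have hL := contDiffOn_gLow hΩ hH hpos
  simp only [nonlinearConnection, poisson, Matrix.of_apply]
  refine (contDiffOn_const.mul (ContDiffOn.sum fun k _ => ?_)).sub
    (contDiffOn_const.mul (ContDiffOn.sum fun k _ => ?_))
  · exact ((contDiffOn_pd hΩ (hL i j) _).mul (contDiffOn_pd hΩ hH _)).sub
      ((contDiffOn_pd hΩ hH _).mul (contDiffOn_pd hΩ (hL i j) _))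
  · exact ((hL i k).mul (contDiffOn_pd hΩ (contDiffOn_pd hΩ hH _) _)).add
      ((hL j k).mul (contDiffOn_pd hΩ (contDiffOn_pd hΩ hH _) _))

theorem contDiffOn_deltaPCoframe (hΩ : IsOpen Ω) (hH : ContDiffOn ℝ ∞ H Ω)
    (hpos : ∀ z ∈ Ω, (gUp H z).PosDef) (i : Fin n) (a : Fin n ⊕ Fin n) :
    ContDiffOn ℝ ∞ (fun z => deltaPCoframe H z i a) Ω := by
  rcases a with j | j
  · simpa [deltaPCoframe] using (contDiffOn_nonlinearConnection hΩ hH hpos i j).neg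
  · simpa [deltaPCoframe] using contDiffOn_const

theorem contDiffOn_sasakiLift (hΩ : IsOpen Ω) (hH : ContDiffOn ℝ ∞ H Ω)
    (hpos : ∀ z ∈ Ω, (gUp H z).PosDef) (a b : Fin n ⊕ Fin n) :
    ContDiffOn ℝ ∞ (fun z => sasakiLift H z a b) Ω := by
  have hD := contDiffOn_deltaPCoframe hΩ hH hpos
  refine ContDiffOn.add ?_ ?_
  · exact contDiffOn_matrix_mul (B := fun _ => dxCoframe n)
      (contDiffOn_matrix_mul (A := fun _ => (dxCoframe n)ᵀ) (fun _ _ => contDiffOn_const)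
        (contDiffOn_gLow hΩ hH hpos)) (fun _ _ => contDiffOn_const) a b
  · exact contDiffOn_matrix_mul (contDiffOn_matrix_mul (fun i j => hD j i)
      (contDiffOn_gUp hΩ hH)) hD a b

theorem gUp_isSymm {z : Coord n} (h : (gUp H z).PosDef) : (gUp H z).IsSymm := by
  ext i j
  exact h.isHermitian.apply i j

theorem gLow_isSymm {z : Coord n} (h : (gUp H z).PosDef) : (gLow H z).IsSymm := by
  rw [Matrix.IsSymm, gLow, Matrix.transpose_nonsing_inv, (gUp_isSymm h).eq]

theorem sasakiLift_isSymm {z : Coord n} (h : (gUp H z).PosDef) : (sasakiLift H z).IsSymm := by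
  simp only [Matrix.IsSymm, sasakiLift, Matrix.transpose_add, Matrix.transpose_mul,
    Matrix.transpose_transpose, (gUp_isSymm h).eq, (gLow_isSymm h).eq, Matrix.mul_assoc]

theorem det_gUp_ne_zero {z : Coord n} (h : (gUp H z).PosDef) : (gUp H z).det ≠ 0 :=
  h.det_pos.ne'

/-- In the adapted coframe `(dx, δp)` the metric is block diagonal, and the change of coframe is
unipotent. -/
theorem det_sasakiLift_ne_zero {z : Coord n} (h : (gUp H z).PosDef) :
    (sasakiLift H z).det ≠ 0 := by
  have hU : IsUnit (gUp H z).det := isUnit_iff_ne_zero.2 (det_gUp_ne_zero h)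
  have hA : sasakiLift H z = (Matrix.fromBlocks 1 0 (-nonlinearConnection H z) 1)ᵀ *
      Matrix.fromBlocks (gLow H z) 0 0 (gUp H z) *
      Matrix.fromBlocks 1 0 (-nonlinearConnection H z) 1 := by
    simp [sasakiLift, dxCoframe, deltaPCoframe, Matrix.transpose_fromCols, Matrix.fromRows_mul,
      Matrix.mul_fromCols, Matrix.fromBlocks_transpose, Matrix.fromBlocks_multiply]
    ext (i | i) (j | j) <;> simp
  rw [hA, Matrix.det_mul, Matrix.det_mul, Matrix.det_transpose, Matrix.det_fromBlocks_zero₁₂,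
    Matrix.det_fromBlocks_zero₁₂]
  simp [gLow, Matrix.det_nonsing_inv, det_gUp_ne_zero h]

theorem pairing_sasakiLift (z v w : Coord n) :
    pairing (sasakiLift H) z v w =
      ∑ i, ∑ j, v (Sum.inl i) * gLow H z i j * w (Sum.inl j) +
      ∑ i, ∑ j, (deltaPCoframe H z *ᵥ v) i * gUp H z i j * (deltaPCoframe H z *ᵥ w) j := by
  have hdx : ∀ u : Coord n, dxCoframe n *ᵥ u = fun i => u (Sum.inl i) := by
    intro u
    ext i
    simp [dxCoframe, Matrix.fromCols_mulVec, Function.comp_def]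
  simp only [pairing, sasakiLift, Matrix.add_mulVec, dotProduct_add, ← Matrix.mulVec_mulVec,
    Matrix.dotProduct_mulVec _ _ᵀ, Matrix.vecMul_transpose, hdx]
  simp only [dotProduct, Matrix.mulVec, Finset.mul_sum, mul_assoc]

theorem deltaPCoframe_mulVec_single_inr (z : Coord n) (k : Fin n) :
    deltaPCoframe H z *ᵥ Pi.single (Sum.inr k) 1 = Pi.single k 1 := by
  ext i
  simp [deltaPCoframe, Matrix.one_apply, Pi.single_apply, eq_comm]

/-- Pairing `v` with `∂/∂p_k` gives the `k`-th entry of the row vector `δp(v)` times `(g^{ij})`,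
which is invertible. -/
theorem deltaPCoframe_mulVec_eq_zero {z : Coord n} (h : (gUp H z).PosDef) {v : Coord n}
    (hv : ∀ u ∈ vertical n z, pairing (sasakiLift H) z v u = 0) : deltaPCoframe H z *ᵥ v = 0 := by
  refine Matrix.eq_zero_of_vecMul_eq_zero (det_gUp_ne_zero h) ?_
  ext k
  have := hv _ (Submodule.subset_span ⟨k, rfl⟩)
  rw [pairing_sasakiLift, deltaPCoframe_mulVec_single_inr] at this
  simpa [Pi.single_apply, Matrix.vecMul, dotProduct] using this

theorem apply_inl_of_mem_vertical {z v : Coord n} (hv : v ∈ vertical n z) (i : Fin n) :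
    v (Sum.inl i) = 0 := by
  induction hv using Submodule.span_induction with
  | mem x hx => obtain ⟨k, rfl⟩ := hx; simp
  | zero => rfl
  | add x y _ _ hx hy => simp [hx, hy]
  | smul a x _ hx => simp [hx]

/-- The derivative of the Sasaki lift, evaluated on horizontal vectors, only involves `g_{ij}`. -/
theorem sum_fderiv_sasakiLift (hΩ : IsOpen Ω) (hH : ContDiffOn ℝ ∞ H Ω)
    (hpos : ∀ z ∈ Ω, (gUp H z).PosDef) {z : Coord n} (hz : z ∈ Ω) {v w : Coord n}
    (hv : deltaPCoframe H z *ᵥ v = 0) (hw : deltaPCoframe H z *ᵥ w = 0) (ζ : Coord n) :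
    ∑ a, ∑ b, v a * fderiv ℝ (fun y => sasakiLift H y a b) z ζ * w b =
      ∑ i, ∑ j, v (Sum.inl i) * fderiv ℝ (fun y => gLow H y i j) z ζ * w (Sum.inl j) := by
  have hd : ∀ {f : Coord n → ℝ}, ContDiffOn ℝ ∞ f Ω → HasFDerivAt f (fderiv ℝ f z) z :=
    fun hf => ((hf.contDiffAt (hΩ.mem_nhds hz)).differentiableAt (by simp)).hasFDerivAt
  -- With `v` and `w` frozen, `y ↦ G_y(v, w)` is differentiated twice: entrywise here, and through
  -- the adapted coframe in `hT`.
  have hS : HasFDerivAt (fun y => pairing (sasakiLift H) y v w)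
      (∑ a, ∑ b, w b • v a • fderiv ℝ (fun y => sasakiLift H y a b) z) z := by
    simp only [pairing_eq_sum]
    exact HasFDerivAt.fun_sum fun a _ => HasFDerivAt.fun_sum fun b _ =>
      ((hd (contDiffOn_sasakiLift hΩ hH hpos a b)).const_mul _).mul_const _
  have hD : ∀ (u : Coord n) i, DifferentiableAt ℝ (fun y => (deltaPCoframe H y *ᵥ u) i) z := by
    intro u i
    simp only [Matrix.mulVec, dotProduct]
    exact DifferentiableAt.fun_sum fun a _ =>
      (hd (contDiffOn_deltaPCoframe hΩ hH hpos i a)).differentiableAt.mul_const _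
  have hT : HasFDerivAt (fun y => pairing (sasakiLift H) y v w)
      (∑ i, ∑ j, w (Sum.inl j) • v (Sum.inl i) • fderiv ℝ (fun y => gLow H y i j) z) z := by
    simp only [pairing_sasakiLift]
    have h1 : HasFDerivAt (fun y => ∑ i, ∑ j, v (Sum.inl i) * gLow H y i j * w (Sum.inl j))
        (∑ i, ∑ j, w (Sum.inl j) • v (Sum.inl i) • fderiv ℝ (fun y => gLow H y i j) z) z :=
      HasFDerivAt.fun_sum fun a _ => HasFDerivAt.fun_sum fun b _ =>
        ((hd (contDiffOn_gLow hΩ hH hpos a b)).const_mul _).mul_const _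
    have h2 : HasFDerivAt (fun y => ∑ i, ∑ j,
        (deltaPCoframe H y *ᵥ v) i * gUp H y i j * (deltaPCoframe H y *ᵥ w) j)
        (∑ i : Fin n, ∑ j : Fin n, (0 : Coord n →L[ℝ] ℝ)) z := by
      -- Both `δp` factors vanish at `z`, so every term of the product rule is zero.
      refine HasFDerivAt.fun_sum fun i _ => HasFDerivAt.fun_sum fun j _ => ?_
      refine (((hD v i).hasFDerivAt.mul (hd (contDiffOn_gUp hΩ hH i j))).mul
        (hD w j).hasFDerivAt).congr_fderiv ?_
      simp [hv, hw]
    exact (h1.add h2).congr_fderiv (by simp)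
  have h := congrArg (fun L : Coord n →L[ℝ] ℝ => L ζ) (hS.unique hT)
  simp only [sum_apply, smul_apply, smul_eq_mul] at h
  refine Eq.trans (Finset.sum_congr rfl fun a _ => Finset.sum_congr rfl fun b _ => ?_)
    (h.trans (Finset.sum_congr rfl fun i _ => Finset.sum_congr rfl fun j _ => ?_)) <;> ring

theorem bundleLikeOn_sasakiLift_iff (hΩ : IsOpen Ω) (hH : ContDiffOn ℝ ∞ H Ω)
    (hpos : ∀ z ∈ Ω, (gUp H z).PosDef) :
    BundleLikeOn Ω (sasakiLift H) (vertical n) ↔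
      ∀ z ∈ Ω, ∀ i j k, pd (Sum.inr k) (fun w => gLow H w i j) z = 0 := by
  -- A vertical vector `ζ`, extended constantly, stays vertical, so `X` and `Y` remain orthogonal to
  -- it on all of `W`.
  have key : ∀ W : Set (Coord n), IsOpen W → W ⊆ Ω → ∀ X Y : Coord n → Coord n,
      ContDiffOn ℝ ∞ X W → ContDiffOn ℝ ∞ Y W →
      (∀ z ∈ W, ∀ v ∈ vertical n z, pairing (sasakiLift H) z (X z) v = 0) →
      (∀ z ∈ W, ∀ v ∈ vertical n z, pairing (sasakiLift H) z (Y z) v = 0) →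
      ∀ z ∈ W, ∀ ζ ∈ vertical n z,
        pairing (sasakiLift H) z
          (leviCivita (sasakiLift H) X Y z + leviCivita (sasakiLift H) Y X z) ζ =
        -∑ i, ∑ j, X z (Sum.inl i) * fderiv ℝ (fun y => gLow H y i j) z ζ * Y z (Sum.inl j) := by
    intro W hW hWΩ X Y hX hY hXv hYv z hz ζ hζ
    have hzΩ := hWΩ hz
    rw [pairing_leviCivita_add_of_orthogonal
      (fun a b => ((contDiffOn_sasakiLift hΩ hH hpos a b).contDiffAt
        (hΩ.mem_nhds hzΩ)).differentiableAt (by simp))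
      (det_sasakiLift_ne_zero (hpos z hzΩ))
      (by filter_upwards [hΩ.mem_nhds hzΩ] with w hw using sasakiLift_isSymm (hpos w hw))
      ((hX.contDiffAt (hW.mem_nhds hz)).differentiableAt (by simp))
      ((hY.contDiffAt (hW.mem_nhds hz)).differentiableAt (by simp))
      (by filter_upwards [hW.mem_nhds hz] with w hw using hXv w hw ζ hζ)
      (by filter_upwards [hW.mem_nhds hz] with w hw using hYv w hw ζ hζ),
      sum_fderiv_sasakiLift hΩ hH hpos hzΩ
        (deltaPCoframe_mulVec_eq_zero (hpos z hzΩ) (hXv z hz))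
        (deltaPCoframe_mulVec_eq_zero (hpos z hzΩ) (hYv z hz))]
  constructor
  · intro hB z hz i j k
    -- The horizontal frame `δ/δx^i = ∂/∂x^i + N_{li} ∂/∂p_l`, whose `dx`-components isolate a
    -- single `g_{ij}`.
    let L : Fin n → Coord n → Coord n := fun i w =>
      Sum.elim (Pi.single i 1) fun l => nonlinearConnection H w l i
    have hL : ∀ i, ContDiffOn ℝ ∞ (L i) Ω := by
      refine fun i => contDiffOn_pi.2 ?_
      rintro (l | l)
      · exact contDiffOn_const
      · exact contDiffOn_nonlinearConnection hΩ hH hpos l i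
    have hLv : ∀ i, ∀ w ∈ Ω, ∀ v ∈ vertical n w, pairing (sasakiLift H) w (L i w) v = 0 := by
      intro i w _ v hv
      have hδ : deltaPCoframe H w *ᵥ L i w = 0 := by
        ext l
        simp [L, deltaPCoframe, Matrix.fromCols_mulVec]
      simp [pairing_sasakiLift, hδ, apply_inl_of_mem_vertical hv]
    have hk : (Pi.single (Sum.inr k) 1 : Coord n) ∈ vertical n z :=
      Submodule.subset_span ⟨k, rfl⟩
    have h1 := key Ω hΩ subset_rfl (L i) (L j) (hL i) (hL j) (hLv i) (hLv j) z hz _ hk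
    rw [hB Ω hΩ subset_rfl (L i) (L j) (fun _ => Pi.single (Sum.inr k) 1) (hL i) (hL j)
      contDiffOn_const (hLv i) (hLv j) (fun w _ => Submodule.subset_span ⟨k, rfl⟩) z hz] at h1
    simpa [L, Pi.single_apply, pd, eq_comm] using h1
  · intro h0 W hW hWΩ X Y Z hX hY _ hXv hYv hZ z hz
    rw [key W hW hWΩ X Y hX hY hXv hYv z hz _ (hZ z hz)]
    have : ∀ i j, fderiv ℝ (fun y => gLow H y i j) z (Z z) = 0 := by
      intro i j
      rw [← sum_mul_pd, Fintype.sum_sum_type]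
      simp [apply_inl_of_mem_vertical (hZ z hz), h0 z (hWΩ hz)]
    simp [this]

/-- Differentiating `(g_{ij})(g^{ij}) = 1` gives `∂g_{ij} = -g_{is} g_{jt} ∂g^{st}`; contracting
with `g_{kh}` finishes. -/
theorem gTensor_eq (hΩ : IsOpen Ω) (hH : ContDiffOn ℝ ∞ H Ω)
    (hpos : ∀ z ∈ Ω, (gUp H z).PosDef) {z : Coord n} (hz : z ∈ Ω) (i j k : Fin n) :
    gTensor H z i j k =
      -(gLow H z *ᵥ fun h => pd (Sum.inr h) (fun w => gLow H w i j) z) k := by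
  have hd : ∀ {f : Coord n → ℝ}, ContDiffOn ℝ ∞ f Ω → HasFDerivAt f (fderiv ℝ f z) z :=
    fun hf => ((hf.contDiffAt (hΩ.mem_nhds hz)).differentiableAt (by simp)).hasFDerivAt
  have hUL : ∀ w ∈ Ω, gLow H w * gUp H w = 1 := fun w hw =>
    Matrix.nonsing_inv_mul _ (isUnit_iff_ne_zero.2 (det_gUp_ne_zero (hpos w hw)))
  have hLU : gUp H z * gLow H z = 1 :=
    Matrix.mul_nonsing_inv _ (isUnit_iff_ne_zero.2 (det_gUp_ne_zero (hpos z hz)))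
  have hmat : ∀ h, Matrix.of (fun s t => pd (Sum.inr h) (fun w => gLow H w s t) z) =
      -(gLow H z * Matrix.of (fun s t => pd (Sum.inr h) (fun w => gUp H w s t) z) *
        gLow H z) := by
    intro h
    have h1 : Matrix.of (fun s t => pd (Sum.inr h) (fun w => gLow H w s t) z) * gUp H z +
        gLow H z * Matrix.of (fun s t => pd (Sum.inr h) (fun w => gUp H w s t) z) = 0 := by
      ext s t
      have hs : HasFDerivAt (fun w => ∑ r, gLow H w s r * gUp H w r t)
          (∑ r, (gLow H z s r • fderiv ℝ (fun w => gUp H w r t) z +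
            gUp H z r t • fderiv ℝ (fun w => gLow H w s r) z)) z :=
        HasFDerivAt.fun_sum fun r _ => (hd (contDiffOn_gLow hΩ hH hpos s r)).mul
          (hd (contDiffOn_gUp hΩ hH r t))
      have hc : (fun w => ∑ r, gLow H w s r * gUp H w r t) =ᶠ[nhds z]
          fun _ => (1 : Matrix (Fin n) (Fin n) ℝ) s t := by
        filter_upwards [hΩ.mem_nhds hz] with w hw
        rw [← hUL w hw, Matrix.mul_apply]
      have h2 := congrArg (fun L : Coord n →L[ℝ] ℝ => L (Pi.single (Sum.inr h) 1))
        (hs.unique ((hasFDerivAt_const _ z).congr_of_eventuallyEq hc))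
      simp only [sum_apply, smul_apply, add_apply, zero_apply, smul_eq_mul] at h2
      rw [Matrix.add_apply, Matrix.mul_apply, Matrix.mul_apply, ← Finset.sum_add_distrib,
        Matrix.zero_apply, ← h2]
      refine Finset.sum_congr rfl fun r _ => ?_
      simp only [Matrix.of_apply, pd]
      ring
    have h2 := congrArg (· * gLow H z) h1
    simp only [Matrix.add_mul, Matrix.mul_assoc, hLU, Matrix.mul_one, Matrix.zero_mul] at h2
    rw [eq_neg_iff_add_eq_zero, Matrix.mul_assoc, h2]
  have hent : ∀ h, pd (Sum.inr h) (fun w => gLow H w i j) z =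
      -∑ s, ∑ t, gLow H z i s * gLow H z j t * pd (Sum.inr h) (fun w => gUp H w s t) z := by
    intro h
    have := congrFun (congrFun (hmat h) i) j
    rw [Matrix.of_apply, Matrix.neg_apply, Matrix.mul_apply] at this
    rw [this, Finset.sum_comm]
    congr 1
    refine Finset.sum_congr rfl fun t _ => ?_
    rw [Matrix.mul_apply, Finset.sum_mul]
    refine Finset.sum_congr rfl fun s _ => ?_
    rw [Matrix.of_apply, (gLow_isSymm (hpos z hz)).apply j t]
    ring
  simp only [gTensor, Matrix.mulVec, dotProduct, hent, mul_neg, Finset.sum_neg_distrib, neg_neg,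
    Finset.mul_sum]
  rw [Finset.sum_congr rfl fun s _ => Finset.sum_comm, Finset.sum_comm]
  exact Finset.sum_congr rfl fun _ _ => Finset.sum_congr rfl fun _ _ =>
    Finset.sum_congr rfl fun _ _ => by ring

theorem gTensor_eq_zero_iff (hΩ : IsOpen Ω) (hH : ContDiffOn ℝ ∞ H Ω)
    (hpos : ∀ z ∈ Ω, (gUp H z).PosDef) {z : Coord n} (hz : z ∈ Ω) :
    (∀ i j k, gTensor H z i j k = 0) ↔
      ∀ i j k, pd (Sum.inr k) (fun w => gLow H w i j) z = 0 := by
  have hdet : (gLow H z).det ≠ 0 := by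
    simp [gLow, Matrix.det_nonsing_inv, det_gUp_ne_zero (hpos z hz)]
  simp only [gTensor_eq hΩ hH hpos hz]
  refine forall_congr' fun i => forall_congr' fun j => ⟨fun h k => ?_, fun h k => ?_⟩
  · exact congrFun (Matrix.eq_zero_of_mulVec_eq_zero hdet (funext fun k => neg_eq_zero.1 (h k))) k
  · simp [h, Matrix.mulVec, dotProduct]

end Local

/-! ### Induced coordinates on the cotangent bundle; dependence on the momenta -/

section Charts

variable {n : ℕ} {M : Type*} [TopologicalSpace M]

theorem continuous_basePoint : Continuous (basePoint (n := n)) :=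
  (PiLp.continuous_toLp 2 _).comp (continuous_pi fun _ => continuous_apply _)

theorem contDiff_basePoint : ContDiff ℝ ∞ (basePoint (n := n)) :=
  PiLp.contDiff_toLp.comp (contDiff_pi.2 fun _ => contDiff_apply _ _ _)

theorem isOpen_slitDomain (e : OpenPartialHomeomorph M (EuclideanSpace ℝ (Fin n))) :
    IsOpen (slitDomain e) := by
  have h : slitDomain e = basePoint ⁻¹' e.target ∩ ⋃ i, {z | z (Sum.inr i) ≠ 0} := by
    ext z
    simp [slitDomain]
  rw [h]
  exact (e.open_target.preimage continuous_basePoint).inter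
    (isOpen_iUnion fun i => isOpen_ne_fun (continuous_apply _) continuous_const)

/-- The affine embedding `p ↦ (q, p)` of a fibre. -/
theorem hasFDerivAt_sumElim (q p : Fin n → ℝ) :
    HasFDerivAt (fun p : Fin n → ℝ => (Sum.elim q p : Coord n))
      (ContinuousLinearMap.pi (Sum.elim (fun _ => 0) fun i => ContinuousLinearMap.proj i) :
        (Fin n → ℝ) →L[ℝ] Coord n) p := by
  refine hasFDerivAt_pi.2 ?_
  rintro (i | i)
  · exact hasFDerivAt_const _ _
  · exact hasFDerivAt_apply i p

theorem sumElim_mem_slitDomain {e : OpenPartialHomeomorph M (EuclideanSpace ℝ (Fin n))}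
    {x : EuclideanSpace ℝ (Fin n)} (hx : x ∈ e.target) {p : Fin n → ℝ} (hp : p ≠ 0) :
    (Sum.elim x p : Coord n) ∈ slitDomain e :=
  ⟨hx, Function.ne_iff.1 hp⟩

variable [ChartedSpace (EuclideanSpace ℝ (Fin n)) M]

/-- The differential of a chart is invertible and the `dx^i` are its components. -/
theorem exists_dxAt_eq {e : OpenPartialHomeomorph M (EuclideanSpace ℝ (Fin n))}
    (he : e ∈ IsManifold.maximalAtlas (𝓡 n) ∞ M) {x : M} (hx : x ∈ e.source) :
    ∃ L : TangentSpace (𝓡 n) x ≃L[ℝ] EuclideanSpace ℝ (Fin n), ∀ i v, dxAt e x i v = L v i := by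
  have he1 : e ∈ IsManifold.maximalAtlas (𝓡 n) 1 M :=
    IsManifold.maximalAtlas_subset_of_le (by simp) he
  have h : e.MDifferentiable (𝓡 n) (𝓡 n) :=
    ⟨fun y hy => (mdifferentiableAt_of_mem_maximalAtlas he1 hy).mdifferentiableWithinAt,
      fun y hy => (mdifferentiableAt_symm_of_mem_maximalAtlas he1 hy).mdifferentiableWithinAt⟩
  exact ⟨h.mfderiv hx, fun i v => rfl⟩

theorem exists_dual_basis {e : OpenPartialHomeomorph M (EuclideanSpace ℝ (Fin n))}
    (he : e ∈ IsManifold.maximalAtlas (𝓡 n) ∞ M) {x : M} (hx : x ∈ e.source) :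
    ∃ v : Fin n → TangentSpace (𝓡 n) x, ∀ i j, dxAt e x i (v j) = if i = j then 1 else 0 := by
  obtain ⟨L, hL⟩ := exists_dxAt_eq he hx
  exact ⟨fun j => L.symm (EuclideanSpace.single j 1), fun i j => by simp [hL]⟩

theorem covector_eq_iff {e : OpenPartialHomeomorph M (EuclideanSpace ℝ (Fin n))}
    (he : e ∈ IsManifold.maximalAtlas (𝓡 n) ∞ M) {x : M} (hx : x ∈ e.source) (p q : Fin n → ℝ) :
    ∑ i, p i • dxAt e x i = ∑ i, q i • dxAt e x i ↔ p = q := by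
  refine ⟨fun h => funext fun j => ?_, fun h => by rw [h]⟩
  obtain ⟨v, hv⟩ := exists_dual_basis he hx
  have := congrArg (fun φ : TangentSpace (𝓡 n) x →L[ℝ] ℝ => φ (v j)) h
  simpa [sum_apply, smul_apply, hv] using this

theorem cotangentPoint_snd_ne_zero {e : OpenPartialHomeomorph M (EuclideanSpace ℝ (Fin n))}
    (he : e ∈ IsManifold.maximalAtlas (𝓡 n) ∞ M) {z : Coord n} (hz : z ∈ slitDomain e) :
    (cotangentPoint e z).2 ≠ 0 := by
  obtain ⟨hb, i, hi⟩ := hz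
  intro h
  refine hi (congrFun ((covector_eq_iff he (e.map_target hb) (fun i => z (Sum.inr i)) 0).1 ?_) i)
  simpa [cotangentPoint] using! h

variable [IsManifold (𝓡 n) ∞ M]

theorem contMDiffAt_dxAt {e : OpenPartialHomeomorph M (EuclideanSpace ℝ (Fin n))}
    (he : e ∈ IsManifold.maximalAtlas (𝓡 n) ∞ M) {x : M} (hx : x ∈ e.source) (i : Fin n) :
    ContMDiffAt (𝓡 n) 𝓘(ℝ, EuclideanSpace ℝ (Fin n) →L[ℝ] ℝ) ∞
      (fun y => ContinuousLinearMap.inCoordinates (EuclideanSpace ℝ (Fin n))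
        (TangentSpace (𝓡 n)) ℝ (Bundle.Trivial M ℝ) x y x y (dxAt e y i)) x := by
  have h := (contMDiffAt_of_mem_maximalAtlas he hx).mfderiv_const (m := ∞) (by simp)
  have h2 : ContMDiffAt (𝓡 n) 𝓘(ℝ, EuclideanSpace ℝ (Fin n) →L[ℝ] ℝ) ∞ (fun y =>
      (EuclideanSpace.proj i : EuclideanSpace ℝ (Fin n) →L[ℝ] ℝ).comp
        (inTangentCoordinates (𝓡 n) (𝓡 n) id e (mfderiv (𝓡 n) (𝓡 n) e) x y)) x :=
    contMDiffAt_const.clm_comp h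
  refine h2.congr_of_eventuallyEq (Filter.Eventually.of_forall fun y => ?_)
  ext v
  simp [ContinuousLinearMap.inCoordinates, inTangentCoordinates, dxAt]
  rfl

/-- Transfers smoothness of `K` on the total space to `K²` in coordinates: the point is `p_i dx^i`
with each `dx^i` a smooth section. -/
theorem contMDiffOn_cotangentPoint {e : OpenPartialHomeomorph M (EuclideanSpace ℝ (Fin n))}
    (he : e ∈ IsManifold.maximalAtlas (𝓡 n) ∞ M) :
    ContMDiffOn 𝓘(ℝ, Coord n) ((𝓡 n).prod 𝓘(ℝ, EuclideanSpace ℝ (Fin n) →L[ℝ] ℝ)) ∞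
      (cotangentPoint e : Coord n → Cotangent n M) (slitDomain e) := by
  intro z hz
  refine ContMDiffAt.contMDiffWithinAt ?_
  have hb : ContMDiffAt 𝓘(ℝ, Coord n) (𝓡 n) ∞ (fun w : Coord n => e.symm (basePoint w)) z :=
    (contMDiffAt_symm_of_mem_maximalAtlas he hz.1).comp z contDiff_basePoint.contMDiff.contMDiffAt
  refine (contMDiffAt_hom_bundle _).2 ⟨hb, ?_⟩
  have h : ContMDiffAt 𝓘(ℝ, Coord n) 𝓘(ℝ, EuclideanSpace ℝ (Fin n) →L[ℝ] ℝ) ∞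
      (fun w : Coord n => ∑ i, w (Sum.inr i) • ContinuousLinearMap.inCoordinates
        (EuclideanSpace ℝ (Fin n)) (TangentSpace (𝓡 n)) ℝ (Bundle.Trivial M ℝ)
        (e.symm (basePoint z)) (e.symm (basePoint w)) (e.symm (basePoint z))
        (e.symm (basePoint w)) (dxAt e (e.symm (basePoint w)) i)) z := by
    refine ContMDiffAt.sum fun i _ => ?_
    have h1 : ContMDiffAt 𝓘(ℝ, Coord n) 𝓘(ℝ, ℝ) ∞ (fun w : Coord n => w (Sum.inr i)) z :=
      (contDiff_apply ℝ ℝ (Sum.inr i : Fin n ⊕ Fin n)).contMDiff.contMDiffAt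
    exact h1.smul ((contMDiffAt_dxAt he (e.map_target hz.1) i).comp z hb)
  refine h.congr_of_eventuallyEq (Filter.Eventually.of_forall fun w => ?_)
  ext v
  simp [ContinuousLinearMap.inCoordinates, cotangentPoint, sum_apply, smul_apply]

theorem contDiffOn_localSq {K : Cotangent n M → ℝ} (hK : IsCartanSpace K)
    {e : OpenPartialHomeomorph M (EuclideanSpace ℝ (Fin n))}
    (he : e ∈ IsManifold.maximalAtlas (𝓡 n) ∞ M) :
    ContDiffOn ℝ ∞ (localSq K e) (slitDomain e) :=
  ((hK.smooth.comp (contMDiffOn_cotangentPoint he)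
    fun _ hz => cotangentPoint_snd_ne_zero he hz).contDiffOn).pow 2

theorem sasakiBundleLikeVertical_iff {K : Cotangent n M → ℝ} (hK : IsCartanSpace K) :
    SasakiBundleLikeVertical K ↔ GTensorVanishes K := by
  refine forall_congr' fun e => forall_congr' fun he => ?_
  rw [bundleLikeOn_sasakiLift_iff (isOpen_slitDomain e) (contDiffOn_localSq hK he)
    (hK.posDef e he)]
  exact forall_congr' fun z => forall_congr' fun hz => (gTensor_eq_zero_iff (isOpen_slitDomain e)
    (contDiffOn_localSq hK he) (hK.posDef e he) hz).symm

/-- Evaluating on the basis dual to `dx^i` gives `g_{ij} = h(v_i, v_j)`, where `p` does not occur.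
-/
theorem gLow_eq_of_isRiemannianMetricOnBase {K : Cotangent n M → ℝ}
    (hR : IsRiemannianMetricOnBase K) {e : OpenPartialHomeomorph M (EuclideanSpace ℝ (Fin n))}
    (he : e ∈ IsManifold.maximalAtlas (𝓡 n) ∞ M) {z w : Coord n} (hz : z ∈ slitDomain e)
    (hw : w ∈ slitDomain e) (hzw : basePoint z = basePoint w) :
    gLow (localSq K e) z = gLow (localSq K e) w := by
  obtain ⟨h, hh⟩ := hR
  ext i j
  obtain ⟨v, hv⟩ := exists_dual_basis he (e.map_target hz.1)
  have h1 := hh e he z hz (v i) (v j)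
  have h2 := hh e he w hw
  rw [← hzw] at h2
  have h3 := h1.symm.trans (h2 (v i) (v j))
  simpa [hv] using h3

theorem basePoint_add_smul_single_inr (z : Coord n) (t : ℝ) (k : Fin n) :
    basePoint (z + t • Pi.single (Sum.inr k) 1) = basePoint z := by
  simp [basePoint]

theorem sasakiBundleLikeVertical_of_isRiemannianMetricOnBase {K : Cotangent n M → ℝ}
    (hK : IsCartanSpace K) (hR : IsRiemannianMetricOnBase K) : SasakiBundleLikeVertical K := by
  intro e he
  rw [bundleLikeOn_sasakiLift_iff (isOpen_slitDomain e) (contDiffOn_localSq hK he)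
    (hK.posDef e he)]
  intro z hz i j k
  have hd : DifferentiableAt ℝ (fun w => gLow (localSq K e) w i j) z :=
    ((contDiffOn_gLow (isOpen_slitDomain e) (contDiffOn_localSq hK he) (hK.posDef e he)
      i j).contDiffAt ((isOpen_slitDomain e).mem_nhds hz)).differentiableAt (by simp)
  rw [pd, ← hd.lineDeriv_eq_fderiv, lineDeriv]
  have hc : Continuous fun t : ℝ => z + t • (Pi.single (Sum.inr k) 1 : Coord n) := by fun_prop
  have hev : (fun t : ℝ => gLow (localSq K e) (z + t • Pi.single (Sum.inr k) 1) i j)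
      =ᶠ[nhds 0] fun _ => gLow (localSq K e) z i j := by
    have hm : slitDomain e ∈ nhds (z + (0 : ℝ) • (Pi.single (Sum.inr k) 1 : Coord n)) := by
      simpa using (isOpen_slitDomain e).mem_nhds hz
    filter_upwards [hc.continuousAt.preimage_mem_nhds hm] with t ht
    rw [gLow_eq_of_isRiemannianMetricOnBase hR he ht hz (basePoint_add_smul_single_inr z t k)]
  rw [hev.deriv_eq, deriv_const]

theorem independentOfMomenta_of_sasakiBundleLikeVertical (hn : n ≠ 1) {K : Cotangent n M → ℝ}
    (hK : IsCartanSpace K) (hB : SasakiBundleLikeVertical K) : IndependentOfMomenta K := by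
  intro e he z hz w hw hzw
  have hB' := (bundleLikeOn_sasakiLift_iff (isOpen_slitDomain e) (contDiffOn_localSq hK he)
    (hK.posDef e he)).1 (hB e he)
  -- A point of the slit domain has a nonzero momentum coordinate, which excludes `n = 0`.
  have hn2 : 1 < n := by
    obtain ⟨-, i, -⟩ := hz
    have := i.pos
    omega
  have hconn : IsPreconnected ({0}ᶜ : Set (Fin n → ℝ)) :=
    (isConnected_compl_singleton_of_one_lt_rank (by simpa using hn2) 0).isPreconnected
  have hL : gLow (localSq K e) z = gLow (localSq K e) w := by
    ext i j
    have hder : ∀ p : Fin n → ℝ, p ≠ 0 → HasFDerivAt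
        (fun p : Fin n → ℝ => gLow (localSq K e) (Sum.elim (basePoint z) p) i j)
        (0 : (Fin n → ℝ) →L[ℝ] ℝ) p := by
      intro p hp
      have hm := sumElim_mem_slitDomain hz.1 hp
      have hd : DifferentiableAt ℝ (fun w => gLow (localSq K e) w i j)
          (Sum.elim (basePoint z) p) :=
        ((contDiffOn_gLow (isOpen_slitDomain e) (contDiffOn_localSq hK he) (hK.posDef e he)
          i j).contDiffAt ((isOpen_slitDomain e).mem_nhds hm)).differentiableAt (by simp)
      refine (hd.hasFDerivAt.comp p (hasFDerivAt_sumElim _ p)).congr_fderiv ?_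
      ext v
      rw [ContinuousLinearMap.comp_apply, ← sum_mul_pd, Fintype.sum_sum_type]
      simp [hB' _ hm]
    have hzE : (Sum.elim (basePoint z) fun k => z (Sum.inr k)) = z := by
      ext (k | k) <;> rfl
    have hwE : (Sum.elim (basePoint z) fun k => w (Sum.inr k)) = w := by
      rw [hzw]
      ext (k | k) <;> rfl
    have := isOpen_compl_singleton.is_const_of_fderiv_eq_zero hconn
      (fun p hp => (hder p hp).differentiableAt.differentiableWithinAt)
      (fun p hp => (hder p hp).fderiv) (x := fun k => z (Sum.inr k)) (y := fun k => w (Sum.inr k))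
      (Function.ne_iff.2 hz.2) (Function.ne_iff.2 hw.2)
    simpa only [hzE, hwE] using this
  have h2 := congrArg (·⁻¹) hL
  simpa only [gLow, Matrix.nonsing_inv_nonsing_inv _
    (isUnit_iff_ne_zero.2 (det_gUp_ne_zero (hK.posDef e he z hz))), Matrix.nonsing_inv_nonsing_inv _
    (isUnit_iff_ne_zero.2 (det_gUp_ne_zero (hK.posDef e he w hw)))] using h2

end Charts

/-! ### Transformation of `g^{ij}` under linear maps of the fibre -/

section FibreTransformation

variable {n : ℕ}

/-- The chain rule along one fibre. Linear combinations are allowed so that it applies both to `H`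
and to its first derivatives. -/
theorem pd_inr_of_fibre_eq {κ : Type*} [Fintype κ] (A : Matrix (Fin n) (Fin n) ℝ)
    {q q' p : Fin n → ℝ} {f : Coord n → ℝ} {f' : κ → Coord n → ℝ} {c : κ → ℝ}
    (hf : DifferentiableAt ℝ f (Sum.elim q p))
    (hf' : ∀ k, DifferentiableAt ℝ (f' k) (Sum.elim q' (A *ᵥ p)))
    (h : ∀ᶠ r in nhds p, f (Sum.elim q r) = ∑ k, c k * f' k (Sum.elim q' (A *ᵥ r)))
    (i : Fin n) :
    pd (Sum.inr i) f (Sum.elim q p) =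
      ∑ k, c k * ∑ l, A l i * pd (Sum.inr l) (f' k) (Sum.elim q' (A *ᵥ p)) := by
  have h1 := hf.hasFDerivAt.comp p (hasFDerivAt_sumElim q p)
  have hA : HasFDerivAt (fun r => A *ᵥ r) A.mulVecLin.toContinuousLinearMap p :=
    A.mulVecLin.toContinuousLinearMap.hasFDerivAt
  have h2 := HasFDerivAt.fun_sum (u := Finset.univ) fun k _ =>
    (((hf' k).hasFDerivAt.comp (A *ᵥ p) (hasFDerivAt_sumElim q' (A *ᵥ p))).comp p hA).const_mul
      (c k)
  have h3 := h1.unique (h2.congr_of_eventuallyEq h)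
  have h4 := congrArg (fun L : (Fin n → ℝ) →L[ℝ] ℝ => L (Pi.single i 1)) h3
  have hs : (Sum.elim (fun _ => 0) (Pi.single i 1) : Coord n) = Pi.single (Sum.inr i) 1 := by
    ext (k | k) <;> simp [Pi.single_apply]
  have hE : ∀ v : Fin n → ℝ, (ContinuousLinearMap.pi (Sum.elim (fun _ => 0)
      fun i => ContinuousLinearMap.proj i) : (Fin n → ℝ) →L[ℝ] Coord n) v =
      Sum.elim (fun _ => 0) v := by
    intro v
    ext (k | k) <;> simp
  simp only [sum_apply, smul_apply, ContinuousLinearMap.comp_apply, hE, hs, smul_eq_mul] at h4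
  refine h4.trans (Finset.sum_congr rfl fun k _ => ?_)
  rw [← sum_mul_pd, Fintype.sum_sum_type]
  simp [Matrix.mulVec_single]

/-- `A` is constant on the fibre, so the second derivatives in `p` pick up no derivative of `A`. -/
theorem gUp_of_fibre_eq (A : Matrix (Fin n) (Fin n) ℝ) {q q' p : Fin n → ℝ}
    {H H' : Coord n → ℝ} {Ω Ω' : Set (Coord n)} (hΩ : IsOpen Ω) (hΩ' : IsOpen Ω')
    (hH : ContDiffOn ℝ ∞ H Ω) (hH' : ContDiffOn ℝ ∞ H' Ω') (hp : Sum.elim q p ∈ Ω)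
    (hp' : Sum.elim q' (A *ᵥ p) ∈ Ω')
    (h : ∀ r, H (Sum.elim q r) = H' (Sum.elim q' (A *ᵥ r))) :
    gUp H (Sum.elim q p) = Aᵀ * gUp H' (Sum.elim q' (A *ᵥ p)) * A := by
  have hd : ∀ {f : Coord n → ℝ} {U : Set (Coord n)}, IsOpen U → ContDiffOn ℝ ∞ f U → ∀ z ∈ U,
      DifferentiableAt ℝ f z :=
    fun hU hf z hz => (hf.contDiffAt (hU.mem_nhds hz)).differentiableAt (by simp)
  have hc : ∀ q : Fin n → ℝ, Continuous fun r : Fin n → ℝ => (Sum.elim q r : Coord n) :=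
    fun q => continuous_iff_continuousAt.2 fun r => (hasFDerivAt_sumElim q r).continuousAt
  have hcA : Continuous fun r : Fin n → ℝ => (Sum.elim q' (A *ᵥ r) : Coord n) :=
    (hc q').comp A.mulVecLin.toContinuousLinearMap.continuous
  have h1 : ∀ j, ∀ᶠ r in nhds p, pd (Sum.inr j) H (Sum.elim q r) =
      ∑ k, A k j * pd (Sum.inr k) H' (Sum.elim q' (A *ᵥ r)) := by
    intro j
    filter_upwards [(hc q).continuousAt.preimage_mem_nhds (hΩ.mem_nhds hp),
      hcA.continuousAt.preimage_mem_nhds (hΩ'.mem_nhds hp')] with r hr hr'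
    have := pd_inr_of_fibre_eq (κ := Unit) (f' := fun _ => H') (c := fun _ => 1) A
      (hd hΩ hH _ hr) (fun _ => hd hΩ' hH' _ hr')
      (Filter.Eventually.of_forall fun s => by simpa using h s) j
    simpa using this
  ext i j
  rw [gUp, Matrix.of_apply, pd_inr_of_fibre_eq A (hd hΩ (contDiffOn_pd hΩ hH _) _ hp)
    (fun k => hd hΩ' (contDiffOn_pd hΩ' hH' _) _ hp') (h1 j) i]
  simp only [Matrix.mul_apply, Matrix.transpose_apply, gUp, Matrix.of_apply, Finset.mul_sum,
    Finset.sum_mul]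
  exact Finset.sum_congr rfl fun _ _ => Finset.sum_congr rfl fun _ _ => by ring

end FibreTransformation

/-- By compactness `B` has a positive minimum `m` on the unit sphere, so `B v v ≥ m ‖v‖²`. -/
theorem isVonNBounded_of_pos {E : Type*} [NormedAddCommGroup E] [NormedSpace ℝ E]
    [FiniteDimensional ℝ E] (B : E →L[ℝ] E →L[ℝ] ℝ) (hB : ∀ v, v ≠ 0 → 0 < B v v) :
    Bornology.IsVonNBounded ℝ {v : E | B v v < 1} := by
  rw [NormedSpace.isVonNBounded_iff, isBounded_iff_forall_norm_le]
  have hcont : Continuous fun v : E => B v v := by fun_prop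
  rcases (Metric.sphere (0 : E) 1).eq_empty_or_nonempty with h0 | h0
  · refine ⟨0, fun v _ => ?_⟩
    by_contra! hv
    have : ‖v‖⁻¹ • v ∈ Metric.sphere (0 : E) 1 := by
      simp [norm_smul, hv.ne']
    simp [h0] at this
  · obtain ⟨u, hu, hmin⟩ := (isCompact_sphere (0 : E) 1).exists_isMinOn h0 hcont.continuousOn
    have hu0 : u ≠ 0 := ne_zero_of_mem_unit_sphere ⟨u, hu⟩
    -- Beyond this radius both `‖v‖ > 1` and `B u u * ‖v‖ > 1`, whence `B v v > 1`.
    refine ⟨(B u u)⁻¹ + 1, fun v hv => ?_⟩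
    by_contra! hlt
    have hBu := hB u hu0
    have hv1 : 1 < ‖v‖ := lt_of_le_of_lt (by simpa using hBu.le) hlt
    have hv0 : ‖v‖ ≠ 0 := (zero_lt_one.trans hv1).ne'
    have hw : ‖v‖⁻¹ • v ∈ Metric.sphere (0 : E) 1 := by
      simp [norm_smul, hv0]
    have h1 : B u u ≤ ‖v‖⁻¹ * (‖v‖⁻¹ * B v v) := by simpa using hmin hw
    have h2 : B u u * ‖v‖ ^ 2 ≤ B v v := by
      calc B u u * ‖v‖ ^ 2 ≤ ‖v‖⁻¹ * (‖v‖⁻¹ * B v v) * ‖v‖ ^ 2 := by gcongr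
        _ = B v v := by field_simp
    have h3 : 1 < B u u * ‖v‖ := by
      have := mul_lt_mul_of_pos_left ((lt_add_one _).trans hlt) hBu
      rwa [mul_inv_cancel₀ hBu.ne'] at this
    have h4 : B v v < 1 := hv
    nlinarith

/-! ### Gluing the chart forms to a Riemannian metric on the base -/

section Charts

variable {n : ℕ} {M : Type*} [TopologicalSpace M] [ChartedSpace (EuclideanSpace ℝ (Fin n)) M]

/-- The form `g_{ij}(x, p) dx^i ⊗ dx^j` in the coordinates induced by `e`. -/
def chartForm (K : Cotangent n M → ℝ) (e : OpenPartialHomeomorph M (EuclideanSpace ℝ (Fin n)))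
    (x : M) (p : Fin n → ℝ) : TangentSpace (𝓡 n) x →L[ℝ] TangentSpace (𝓡 n) x →L[ℝ] ℝ :=
  ∑ i, ∑ j, gLow (localSq K e) (Sum.elim (e x) p) i j • (dxAt e x i).smulRight (dxAt e x j)

theorem chartForm_apply (K : Cotangent n M → ℝ)
    (e : OpenPartialHomeomorph M (EuclideanSpace ℝ (Fin n))) (x : M) (p : Fin n → ℝ)
    (v w : TangentSpace (𝓡 n) x) :
    chartForm K e x p v w = ∑ i, ∑ j, gLow (localSq K e) (Sum.elim (e x) p) i j *
      dxAt e x i v * dxAt e x j w := by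
  simp [chartForm, sum_apply, smul_apply, mul_assoc]

theorem chartForm_eq_dotProduct (K : Cotangent n M → ℝ)
    (e : OpenPartialHomeomorph M (EuclideanSpace ℝ (Fin n))) (x : M) (p : Fin n → ℝ)
    (v w : TangentSpace (𝓡 n) x) :
    chartForm K e x p v w = (fun i => dxAt e x i v) ⬝ᵥ
      (gLow (localSq K e) (Sum.elim (e x) p) *ᵥ fun i => dxAt e x i w) := by
  simp only [chartForm_apply, dotProduct, Matrix.mulVec, Finset.mul_sum]
  exact Finset.sum_congr rfl fun _ _ => Finset.sum_congr rfl fun _ _ => by ring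

theorem localSq_sumElim (K : Cotangent n M → ℝ)
    {e : OpenPartialHomeomorph M (EuclideanSpace ℝ (Fin n))} {x : M} (hx : x ∈ e.source)
    (p : Fin n → ℝ) :
    localSq K e (Sum.elim (e x) p) = K ⟨x, ∑ i, p i • dxAt e x i⟩ ^ 2 := by
  have h : cotangentPoint e (Sum.elim (e x) p) = (⟨x, ∑ i, p i • dxAt e x i⟩ : Cotangent n M) := by
    have hb : e.symm (basePoint (Sum.elim (e x) p)) = x := e.left_inv hx
    simp only [cotangentPoint, Sum.elim_inr]
    rw [hb]
  rw [localSq, h]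

variable [IsManifold (𝓡 n) ∞ M]

theorem chartForm_eq_chartForm {K : Cotangent n M → ℝ} (hK : IsCartanSpace K)
    {e e' : OpenPartialHomeomorph M (EuclideanSpace ℝ (Fin n))}
    (he : e ∈ IsManifold.maximalAtlas (𝓡 n) ∞ M) (he' : e' ∈ IsManifold.maximalAtlas (𝓡 n) ∞ M)
    {x : M} (hx : x ∈ e.source) (hx' : x ∈ e'.source) {p : Fin n → ℝ} (hp : p ≠ 0) :
    ∃ p' ≠ 0, chartForm K e x p = chartForm K e' x p' := by
  obtain ⟨L', hL'⟩ := exists_dxAt_eq he' hx'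
  -- Coefficients of `dx^i` in the coframe of `e'`: the covector with momenta `r` in `e` has momenta
  -- `A *ᵥ r` in `e'`.
  let A : Matrix (Fin n) (Fin n) ℝ :=
    Matrix.of fun k i => dxAt e x i (L'.symm (EuclideanSpace.single k 1))
  have hdx : ∀ i v, dxAt e x i v = ∑ k, A k i * dxAt e' x k v := by
    intro i v
    have hv : v = ∑ k, dxAt e' x k v • L'.symm (EuclideanSpace.single k 1) := by
      apply L'.injective
      ext l
      simp [hL', Pi.single_apply]
    conv_lhs => rw [hv, map_sum]
    refine Finset.sum_congr rfl fun k _ => ?_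
    rw [map_smul, smul_eq_mul, mul_comm]
    rfl
  have hcov : ∀ r : Fin n → ℝ, ∑ i, r i • dxAt e x i = ∑ k, (A *ᵥ r) k • dxAt e' x k := by
    intro r
    ext v
    simp only [sum_apply, smul_apply, smul_eq_mul, hdx, Matrix.mulVec, dotProduct, Finset.sum_mul,
      Finset.mul_sum]
    rw [Finset.sum_comm]
    exact Finset.sum_congr rfl fun _ _ => Finset.sum_congr rfl fun _ _ => by ring
  have hinj : ∀ r : Fin n → ℝ, A *ᵥ r = 0 → r = 0 := by
    intro r hr
    refine (covector_eq_iff he hx r 0).1 ?_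
    rw [hcov r, hr]
    simp
  have hdet : IsUnit A.det := by
    rw [isUnit_iff_ne_zero]
    intro h0
    obtain ⟨r, hr, hr0⟩ := Matrix.exists_mulVec_eq_zero_iff.2 h0
    exact hr (hinj r hr0)
  refine ⟨A *ᵥ p, fun h => hp (hinj p h), ?_⟩
  have hU := gUp_of_fibre_eq A (isOpen_slitDomain e) (isOpen_slitDomain e')
    (contDiffOn_localSq hK he) (contDiffOn_localSq hK he')
    (sumElim_mem_slitDomain (e.map_source hx) hp)
    (sumElim_mem_slitDomain (e'.map_source hx') fun h => hp (hinj p h))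
    (fun r => by rw [localSq_sumElim K hx, localSq_sumElim K hx', hcov])
  ext v w
  have hdv : ∀ v, (fun i => dxAt e x i v) = Aᵀ *ᵥ fun k => dxAt e' x k v := by
    intro v
    ext i
    simp [hdx, Matrix.mulVec, dotProduct]
  -- Inverting `Aᵀ g' A` produces `A⁻¹` and `(Aᵀ)⁻¹`, which cancel against the change of coframe.
  rw [chartForm_eq_dotProduct, chartForm_eq_dotProduct, hdv, hdv, gLow, hU, Matrix.mul_inv_rev,
    Matrix.mul_inv_rev, Matrix.mulVec_transpose, ← Matrix.dotProduct_mulVec, Matrix.mulVec_mulVec,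
    Matrix.mulVec_mulVec, ← Matrix.mul_assoc, ← Matrix.mul_assoc, Matrix.mul_nonsing_inv _ hdet,
    Matrix.one_mul, Matrix.mul_assoc, Matrix.nonsing_inv_mul _ (by rwa [Matrix.det_transpose]),
    Matrix.mul_one, gLow]

theorem chartForm_eq_of_independentOfMomenta {K : Cotangent n M → ℝ} (hK : IsCartanSpace K)
    (hI : IndependentOfMomenta K) {e e' : OpenPartialHomeomorph M (EuclideanSpace ℝ (Fin n))}
    (he : e ∈ IsManifold.maximalAtlas (𝓡 n) ∞ M) (he' : e' ∈ IsManifold.maximalAtlas (𝓡 n) ∞ M)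
    {x : M} (hx : x ∈ e.source) (hx' : x ∈ e'.source) {p q : Fin n → ℝ} (hp : p ≠ 0)
    (hq : q ≠ 0) : chartForm K e x p = chartForm K e' x q := by
  obtain ⟨p', hp', h⟩ := chartForm_eq_chartForm hK he he' hx hx' hp
  rw [h, chartForm, chartForm, gLow, gLow,
    hI e' he' _ (sumElim_mem_slitDomain (e'.map_source hx') hp') _
      (sumElim_mem_slitDomain (e'.map_source hx') hq) rfl]

theorem contMDiffAt_chartForm {K : Cotangent n M → ℝ} (hK : IsCartanSpace K)
    {e : OpenPartialHomeomorph M (EuclideanSpace ℝ (Fin n))}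
    (he : e ∈ IsManifold.maximalAtlas (𝓡 n) ∞ M) {x : M} (hx : x ∈ e.source) {p : Fin n → ℝ}
    (hp : Nonempty (Fin n) → p ≠ 0) :
    ContMDiffAt (𝓡 n)
      ((𝓡 n).prod 𝓘(ℝ, EuclideanSpace ℝ (Fin n) →L[ℝ] EuclideanSpace ℝ (Fin n) →L[ℝ] ℝ)) ∞
      (fun y => Bundle.TotalSpace.mk'
        (EuclideanSpace ℝ (Fin n) →L[ℝ] EuclideanSpace ℝ (Fin n) →L[ℝ] ℝ)
        (E := fun y : M => TangentSpace (𝓡 n) y →L[ℝ] TangentSpace (𝓡 n) y →L[ℝ] ℝ)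
        y (chartForm K e y p)) x := by
  refine (contMDiffAt_hom_bundle _).2 ⟨contMDiffAt_id, ?_⟩
  let D : Fin n → M → (EuclideanSpace ℝ (Fin n) →L[ℝ] ℝ) := fun i y =>
    ContinuousLinearMap.inCoordinates (EuclideanSpace ℝ (Fin n))
        (TangentSpace (𝓡 n)) ℝ (Bundle.Trivial M ℝ) x y x y (dxAt e y i)
  have hD : ∀ i, ContMDiffAt (𝓡 n) 𝓘(ℝ, EuclideanSpace ℝ (Fin n) →L[ℝ] ℝ) ∞ (D i) x :=
    contMDiffAt_dxAt he hx
  have h : ContMDiffAt (𝓡 n)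
      𝓘(ℝ, EuclideanSpace ℝ (Fin n) →L[ℝ] EuclideanSpace ℝ (Fin n) →L[ℝ] ℝ) ∞
      (fun y => ∑ i, ∑ j, gLow (localSq K e) (Sum.elim (e y) p) i j •
        ContinuousLinearMap.smulRightL ℝ (EuclideanSpace ℝ (Fin n))
          (EuclideanSpace ℝ (Fin n) →L[ℝ] ℝ) (D i y) (D j y)) x := by
    refine ContMDiffAt.sum fun i _ => ContMDiffAt.sum fun j _ => ?_
    have hm := sumElim_mem_slitDomain (e.map_source hx) (hp ⟨i⟩)
    have hq : ContDiff ℝ ∞ fun q : EuclideanSpace ℝ (Fin n) => (Sum.elim q p : Coord n) := by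
      refine contDiff_pi.2 ?_
      rintro (k | k)
      · exact (EuclideanSpace.proj k : EuclideanSpace ℝ (Fin n) →L[ℝ] ℝ).contDiff
      · exact contDiff_const
    have h1 : ContMDiffAt (𝓡 n) 𝓘(ℝ, ℝ) ∞
        (fun y => gLow (localSq K e) (Sum.elim (e y) p) i j) x :=
      (((contDiffOn_gLow (isOpen_slitDomain e) (contDiffOn_localSq hK he) (hK.posDef e he)
        i j).contDiffAt ((isOpen_slitDomain e).mem_nhds hm)).contMDiffAt.comp (e x)
        hq.contMDiff.contMDiffAt).comp x (contMDiffAt_of_mem_maximalAtlas he hx)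
    exact h1.smul ((contMDiffAt_const.clm_apply (hD i)).clm_apply (hD j))
  refine h.congr_of_eventuallyEq ?_
  -- The trivialization formula holds only over its base set, the source of the chart at `x`.
  filter_upwards [(chartAt (EuclideanSpace ℝ (Fin n)) x).open_source.mem_nhds
    (mem_chart_source _ x)] with y hy
  ext v w
  have hb : y ∈ (trivializationAt (EuclideanSpace ℝ (Fin n)) (TangentSpace (𝓡 n)) x).baseSet := hy
  refine (inCoordinates_apply_eq₂ (E₃ := Bundle.Trivial M ℝ) hb hb (Set.mem_univ _)).trans ?_
  simp [chartForm_apply, D, sum_apply, smul_apply, ContinuousLinearMap.inCoordinates, mul_assoc]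
  have hs := fun u => (Bundle.Trivialization.symmL_apply (R := ℝ)
    (trivializationAt (EuclideanSpace ℝ (Fin n)) (TangentSpace (𝓡 n)) x) hb u).symm
  exact Finset.sum_congr rfl fun i _ => Finset.sum_congr rfl fun j _ => congrArg _
    (congrArg₂ _ (congrArg (dxAt e y i) (hs v)) (congrArg (dxAt e y j) (hs w)))

theorem isRiemannianMetricOnBase_of_independentOfMomenta {K : Cotangent n M → ℝ}
    (hK : IsCartanSpace K) (hI : IndependentOfMomenta K) : IsRiemannianMetricOnBase K := by
  -- The reference covector has all momenta `1`. It is zero when `n = 0`, where the chart forms are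
  -- empty sums.
  have hone : Nonempty (Fin n) → (1 : Fin n → ℝ) ≠ 0 := fun ⟨i⟩ h => by simpa using congrFun h i
  have hatlas : ∀ x : M, chartAt (EuclideanSpace ℝ (Fin n)) x ∈
      IsManifold.maximalAtlas (𝓡 n) ∞ M := fun x => IsManifold.chart_mem_maximalAtlas x
  have hempty : IsEmpty (Fin n) → ∀ x : M, ∀ v : TangentSpace (𝓡 n) x, v = 0 := by
    intro h x v
    have : Subsingleton (EuclideanSpace ℝ (Fin n)) := inferInstance
    exact this.elim _ _
  have heq : ∀ (e) (_ : e ∈ IsManifold.maximalAtlas (𝓡 n) ∞ M)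
      (e') (_ : e' ∈ IsManifold.maximalAtlas (𝓡 n) ∞ M) (x : M) (_ : x ∈ e.source)
      (_ : x ∈ e'.source) (p q : Fin n → ℝ) (_ : Nonempty (Fin n) → p ≠ 0)
      (_ : Nonempty (Fin n) → q ≠ 0), chartForm K e x p = chartForm K e' x q := by
    intro e he e' he' x hx hx' p q hp hq
    rcases isEmpty_or_nonempty (Fin n) with h | h
    · simp [chartForm]
    · exact chartForm_eq_of_independentOfMomenta hK hI he he' hx hx' (hp h) (hq h)
  have hposdef : ∀ x : M, Nonempty (Fin n) → (gUp (localSq K (chartAt _ x))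
      (Sum.elim (chartAt (EuclideanSpace ℝ (Fin n)) x x) 1)).PosDef := fun x h =>
    hK.posDef _ (hatlas x) _ (sumElim_mem_slitDomain (mem_chart_target _ x) (hone h))
  have hpos : ∀ (x : M) (v : TangentSpace (𝓡 n) x), v ≠ 0 →
      0 < chartForm K (chartAt (EuclideanSpace ℝ (Fin n)) x) x 1 v v := by
    intro x v hv
    have hne : Nonempty (Fin n) := by
      by_contra h
      exact hv (hempty (not_nonempty_iff.1 h) x v)
    obtain ⟨L, hL⟩ := exists_dxAt_eq (hatlas x) (mem_chart_source _ x)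
    rw [chartForm_eq_dotProduct]
    refine (hposdef x hne).inv.dotProduct_mulVec_pos fun h => hv (L.injective ?_)
    ext i
    simpa [hL] using congrFun h i
  refine ⟨{ inner := fun x => chartForm K (chartAt (EuclideanSpace ℝ (Fin n)) x) x 1
            symm := ?_, pos := hpos, isVonNBounded := ?_, contMDiff := ?_ }, ?_⟩
  · intro x v w
    rcases isEmpty_or_nonempty (Fin n) with h | h
    · simp [chartForm]
    · rw [chartForm_eq_dotProduct, chartForm_eq_dotProduct, dotProduct_comm,
        Matrix.dotProduct_mulVec, ← Matrix.mulVec_transpose, (gLow_isSymm (hposdef x h)).eq,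
        dotProduct_comm, dotProduct_comm]
  · intro x
    exact isVonNBounded_of_pos (E := EuclideanSpace ℝ (Fin n)) _ (hpos x)
  · intro x
    -- The chart used at `y` varies with `y`; chart independence replaces it near `x` by the fixed
    -- chart at `x`.
    refine (contMDiffAt_chartForm hK (hatlas x) (mem_chart_source _ x)
      hone).congr_of_eventuallyEq ?_
    filter_upwards [(chartAt (EuclideanSpace ℝ (Fin n)) x).open_source.mem_nhds
      (mem_chart_source _ x)] with y hy
    rw [heq _ (hatlas y) _ (hatlas x) y (mem_chart_source _ y) hy 1 1 hone hone]
  · intro e he z hz v w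
    have hb : (basePoint z : EuclideanSpace ℝ (Fin n)) = e (e.symm (basePoint z)) :=
      (e.right_inv hz.1).symm
    have hzE : z = Sum.elim (e (e.symm (basePoint z))) fun k => z (Sum.inr k) := by
      rw [← hb]
      ext (k | k) <;> rfl
    change chartForm K (chartAt _ (e.symm (basePoint z))) (e.symm (basePoint z)) 1 v w = _
    rw [heq _ (hatlas _) e he _ (mem_chart_source _ _) (e.map_target hz.1) 1
      (fun k => z (Sum.inr k)) hone fun _ => Function.ne_iff.2 hz.2, chartForm_apply, ← hzE]

end Charts

end CartanSpaces

end

theorem mainTheorem7 (n : ℕ) {M : Type*} [TopologicalSpace M]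
    [ChartedSpace (EuclideanSpace ℝ (Fin n)) M] [IsManifold (𝓡 n) ∞ M]
    (K : CartanSpaces.Cotangent n M → ℝ) (hK : CartanSpaces.IsCartanSpace K) :
    (CartanSpaces.SasakiBundleLikeVertical K ↔ CartanSpaces.GTensorVanishes K) ∧
    (CartanSpaces.IsRiemannianMetricOnBase K → CartanSpaces.SasakiBundleLikeVertical K) ∧
    (n ≠ 1 →
      (CartanSpaces.SasakiBundleLikeVertical K ↔
        CartanSpaces.IndependentOfMomenta K ∧ CartanSpaces.IsRiemannianMetricOnBase K)) := by
  refine ⟨CartanSpaces.sasakiBundleLikeVertical_iff hK,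
    CartanSpaces.sasakiBundleLikeVertical_of_isRiemannianMetricOnBase hK, fun hn => ⟨fun hB => ?_,
      fun h => CartanSpaces.sasakiBundleLikeVertical_of_isRiemannianMetricOnBase hK h.2⟩⟩
  have hI := CartanSpaces.independentOfMomenta_of_sasakiBundleLikeVertical hn hK hB
  exact ⟨hI, CartanSpaces.isRiemannianMetricOnBase_of_independentOfMomenta hK hI⟩
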